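/- Let $\varphi$ be the Laplace transform of a probability distribution $\nu$ on $[0,\infty)$, $\varphi(z)=\int_{[0,\infty)} e^{-zu}\,\nu(du)$ for $\operatorname{Re} z\ge 0$. A characteristic function (CF) is a function of the form $t\mapsto\int_{\mathbb R} e^{itx}\,\mu(dx)$, $t\in\mathbb R$, with $\mu$ a Borel probability measure on $\mathbb R$. A CF $f$ is called $\varphi$-infinitely divisible ($\varphi$-ID) if there exist constants $a_n>0$ and CFs $f_n$, $n\ge 1$, such that $$\lim_{n\to\infty}\varphi\{a_n(1-f_n(t))\}=f(t)\quad\text{for all } t\in\mathbb R.$$ The domain of partial $\varphi$-attraction of a CF $f$ is the set of all CFs $g$ for which there exist positive integers $n_k\to\infty$ and real constants $a_k>0$ and $b_k$ such that, with $g_k(t)=g(t/a_k)\,e^{-itb_k}$, $$\lim_{k\to\infty}\varphi\{n_k(1-g_k(t))\}=f(t)\quad\text{for all } t\in\mathbb R.$$ **Theorem 4.2.** A CF $f$ has a nonempty domain of partial $\varphi$-attraction if and only if $f$ is $\varphi$-ID. -/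

import Mathlib

open Filter Topology MeasureTheory

/-- `f` is a characteristic function (CF): the Fourier transform `t ↦ ∫ exp (i t x) dμ(x)`
of a Borel probability measure on `ℝ`. -/
def IsCF (f : ℝ → ℂ) : Prop :=
  ∃ μ : Measure ℝ, IsProbabilityMeasure μ ∧ f = charFun μ

/-- `φ` is the Laplace transform (LT) of a probability distribution `ν` on `[0, ∞)`, on its
natural domain, the closed right half-plane (which contains all the numbers `a (1 - h)` with
`0 < a` and `‖h‖ ≤ 1` at which it is evaluated below; the values of `φ` elsewhere play no role). -/
def IsLT (φ : ℂ → ℂ) : Prop :=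
  ∃ ν : Measure ℝ, IsProbabilityMeasure ν ∧ ν (Set.Iio 0) = 0 ∧
    ∀ z : ℂ, 0 ≤ z.re → φ z = ∫ u : ℝ, Complex.exp (-(z * (u : ℂ))) ∂ν

/-- `f` is `φ`-infinitely divisible: the pointwise limit of the CFs `φ {a_n (1 - f_n)}` of sums
of `N_n` independent summands with CF `f_n`, where `N_n` is independent of the summands and has
probability generating function `s ↦ φ {a_n (1 - s)}`. -/
def IsPhiID (φ : ℂ → ℂ) (f : ℝ → ℂ) : Prop :=
  ∃ (a : ℕ → ℝ) (h : ℕ → ℝ → ℂ), (∀ n, 0 < a n) ∧ (∀ n, IsCF (h n)) ∧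
    ∀ t : ℝ, Tendsto (fun n => φ ((a n : ℂ) * (1 - h n t))) atTop (𝓝 (f t))

/-- `t ↦ g (t / a) exp (-i t b)`: the CF of `X / a - b` when `X` has CF `g`. -/
noncomputable def normedCF (g : ℝ → ℂ) (a b : ℝ) (t : ℝ) : ℂ :=
  g (t / a) * Complex.exp (-(Complex.I * (t : ℂ) * (b : ℂ)))

/-- The domain of partial `φ`-attraction of `f`: the set of all CFs `g` such that
`φ {n_k (1 - g_k)} → f` pointwise, where `g_k (t) = g (t / a_k) exp (-i t b_k)`, for some
positive integers `n_k → ∞` and some real constants `a_k > 0` and `b_k`. -/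
def partialPhiAttractionDomain (φ : ℂ → ℂ) (f : ℝ → ℂ) : Set (ℝ → ℂ) :=
  {g | IsCF g ∧ ∃ (n : ℕ → ℕ) (a b : ℕ → ℝ),
    (∀ k, 0 < n k) ∧ Tendsto n atTop atTop ∧ (∀ k, 0 < a k) ∧
    ∀ t : ℝ, Tendsto (fun k => φ ((n k : ℂ) * (1 - normedCF g (a k) (b k) t)))
      atTop (𝓝 (f t))}

/-! Doeblin's universal-law construction. Attraction gives `φ`-ID at once, with the integers `n k`
as constants. Conversely, from `a j` and CFs `f j`, form one mixture `g = 1 - ∑ p j (1 - f j (α j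
·))` with `p j = a j / n j`. In `n k (1 - g (t / α k))` the term `j = k` is exactly `a k (1 - f k
t)`. Terms `j < k` vanish because `α j / α k` is tiny and `f j` is continuous at 0 with value 1;
terms `j > k` because `n k * p j` is below a geometric tail. Uniform continuity of `φ` then
transfers the limit. -/

open Finset in
/-- Real weights `a j` can be divided by integers growing so fast that the quotients, even
after multiplication by any earlier integer, are dominated by a geometric series. -/
lemma exists_fast_growing_nat (a : ℕ → ℝ) :
    ∃ n : ℕ → ℕ, (∀ k, 0 < n k) ∧ Tendsto n atTop atTop ∧
      (∀ j, a j / n j ≤ (1 / 2) ^ (j + 1)) ∧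
      ∀ k j, k < j → n k * (a j / n j) ≤ (1 / 2) ^ (j + 1) := by
  -- The `+ 1` keeps every factor positive whatever `a i` is; the power of 2 yields both the
  -- geometric bound and `n k → ∞`.
  set c : ℕ → ℕ := fun i => (⌈a i⌉₊ + 1) * 2 ^ (i + 1) with hc
  have hc1 : ∀ i, 1 ≤ c i := fun i => Nat.one_le_iff_ne_zero.mpr (by positivity)
  have hca : ∀ i, a i * 2 ^ (i + 1) ≤ c i := fun i => by
    simp only [hc]
    push_cast
    gcongr
    linarith [Nat.le_ceil (a i)]
  set n : ℕ → ℕ := fun k => ∏ i ∈ range (k + 1), c i with hn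
  have hpos : ∀ k, 0 < n k := fun k => prod_pos fun i _ => hc1 i
  have hmono : ∀ k j, k < j → n k * c j ≤ n j := fun k j hkj => by
    simp only [hn, prod_range_succ _ j]
    exact Nat.mul_le_mul_right _
      (prod_le_prod_of_subset_of_one_le' (range_mono hkj) fun i _ _ => hc1 i)
  have hle : ∀ j, c j ≤ n j := fun j =>
    single_le_prod' (fun i _ => hc1 i) (self_mem_range_succ j)
  have key : ∀ (m : ℝ) j, 0 ≤ m → m * c j ≤ n j → m * (a j / n j) ≤ (1 / 2) ^ (j + 1) := by
    intro m j hm h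
    have h0 : (0 : ℝ) < n j := by exact_mod_cast hpos j
    rw [one_div, inv_pow, ← mul_div_assoc, div_le_iff₀ h0, inv_mul_eq_div,
      le_div_iff₀ (by positivity), mul_assoc]
    exact (mul_le_mul_of_nonneg_left (hca j) hm).trans h
  refine ⟨n, hpos, ?_, fun j => ?_, fun k j hkj => ?_⟩
  · refine tendsto_atTop_mono (fun k => ?_) tendsto_id
    have h1 : k + 1 < 2 ^ (k + 1) := Nat.lt_two_pow_self
    have h2 : 2 ^ (k + 1) ≤ c k := Nat.le_mul_of_pos_left _ (Nat.succ_pos _)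
    have := hle k
    simp only [id]
    omega
  · simpa using key 1 j zero_le_one (by simpa using hle j)
  · exact key (n k) j (Nat.cast_nonneg _) (by exact_mod_cast hmono k j hkj)

open Finset in
/-- Scales growing so fast that the ratio of an earlier one to the `k`-th one brings `[-k, k]`
into any prescribed interval `[-D k, D k]`. -/
lemma exists_fast_growing_scale (D : ℕ → ℝ) (hD : ∀ k, 0 < D k) :
    ∃ α : ℕ → ℝ, (∀ k, 0 < α k) ∧
      ∀ k j : ℕ, j < k → ∀ t : ℝ, |t| ≤ k → |α j * (t / α k)| ≤ D k := by
  -- Chosen so that `D k * c k = D k + k ≥ k`, while `c ≥ 1` makes the products monotone.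
  set c : ℕ → ℝ := fun i => 1 + i / D i with hc
  have hc1 : ∀ i, 1 ≤ c i := fun i => by
    have := hD i
    simp only [hc]
    have : 0 ≤ (i : ℝ) / D i := by positivity
    linarith
  have hc0 : ∀ i, 0 < c i := fun i => zero_lt_one.trans_le (hc1 i)
  set α : ℕ → ℝ := fun k => ∏ i ∈ range (k + 1), c i with hα
  have hpos : ∀ k, 0 < α k := fun k => prod_pos fun i _ => hc0 i
  refine ⟨α, hpos, fun k j hjk t ht => ?_⟩
  have hmono : α j * c k ≤ α k := by
    have hα_mono : Monotone fun m => ∏ i ∈ range m, c i := monotone_nat_of_le_succ fun m => by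
      rw [prod_range_succ]
      exact le_mul_of_one_le_right (prod_nonneg fun i _ => (hc0 i).le) (hc1 m)
    simp only [hα, prod_range_succ _ k]
    exact mul_le_mul_of_nonneg_right (hα_mono hjk) (hc0 k).le
  have hk : (k : ℝ) ≤ D k * c k := by
    have : D k * c k = D k + k := by
      have := (hD k).ne'
      simp only [hc]
      field_simp
    linarith [hD k]
  rw [abs_mul, abs_div, abs_of_pos (hpos j), abs_of_pos (hpos k), ← mul_div_assoc,
    div_le_iff₀ (hpos k)]
  calc α j * |t| ≤ α j * (D k * c k) := mul_le_mul_of_nonneg_left (ht.trans hk) (hpos j).le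
    _ = D k * (α j * c k) := by ring
    _ ≤ D k * α k := mul_le_mul_of_nonneg_left hmono (hD k).le

namespace IsCF

lemma norm_le_one {f : ℝ → ℂ} (hf : IsCF f) (t : ℝ) : ‖f t‖ ≤ 1 := by
  obtain ⟨μ, _, rfl⟩ := hf
  exact norm_charFun_le_one t

lemma apply_zero {f : ℝ → ℂ} (hf : IsCF f) : f 0 = 1 := by
  obtain ⟨μ, _, rfl⟩ := hf
  simp

lemma norm_one_sub_le_two {f : ℝ → ℂ} (hf : IsCF f) (t : ℝ) : ‖1 - f t‖ ≤ 2 := by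
  obtain ⟨μ, _, rfl⟩ := hf
  exact norm_one_sub_charFun_le_two

protected lemma continuous {f : ℝ → ℂ} (hf : IsCF f) : Continuous f := by
  obtain ⟨μ, _, rfl⟩ := hf
  exact continuous_charFun

lemma comp_mul_left {f : ℝ → ℂ} (hf : IsCF f) (c : ℝ) : IsCF fun t => f (c * t) := by
  obtain ⟨μ, _, rfl⟩ := hf
  exact ⟨μ.map (c * ·), Measure.isProbabilityMeasure_map (by fun_prop),
    funext fun t => (charFun_map_mul c t).symm⟩

lemma normedCF {g : ℝ → ℂ} (hg : IsCF g) (a b : ℝ) : IsCF (normedCF g a b) := by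
  obtain ⟨μ, hμ, h⟩ := hg.comp_mul_left a⁻¹
  refine ⟨μ.map (· + -b), Measure.isProbabilityMeasure_map (by fun_prop), funext fun t => ?_⟩
  rw [charFun_map_add_const, ← congrFun h t, _root_.normedCF, div_eq_inv_mul]
  congr 2
  simp
  ring

/-- A mixture of characteristic functions, the missing mass being placed at the origin. -/
lemma one_sub_tsum {f : ℕ → ℝ → ℂ} (hf : ∀ j, IsCF (f j)) {p : ℕ → ℝ} (hp : ∀ j, 0 ≤ p j)
    (hs : Summable p) (h1 : ∑' j, p j ≤ 1) : IsCF fun t => 1 - ∑' j, p j * (1 - f j t) := by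
  choose μ hμ hfμ using hf
  set ρ : Measure ℝ := Measure.sum fun j => ENNReal.ofReal (p j) • μ j with hρ
  have hρu : ρ Set.univ = ENNReal.ofReal (∑' j, p j) := by
    simp [hρ, ENNReal.ofReal_tsum_of_nonneg hp hs]
  have : IsFiniteMeasure ρ := ⟨by simp [hρu]⟩
  have hsc : Summable fun j => (p j : ℂ) := Complex.summable_ofReal.mpr hs
  refine ⟨ENNReal.ofReal (1 - ∑' j, p j) • Measure.dirac 0 + ρ, ⟨?_⟩, funext fun t => ?_⟩
  · rw [Measure.add_apply, hρu, Measure.smul_apply, measure_univ, smul_eq_mul, mul_one,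
      ← ENNReal.ofReal_add (sub_nonneg.mpr h1) (tsum_nonneg hp)]
    simp
  · have hint : ∀ (m : Measure ℝ) [IsFiniteMeasure m],
        Integrable (fun x : ℝ => Complex.exp (t * x * Complex.I)) m := fun m _ => by
      refine Integrable.of_bound (by fun_prop) 1 (ae_of_all _ fun x => ?_)
      rw [← Complex.ofReal_mul, Complex.norm_exp_ofReal_mul_I]
    have hsum : HasSum (fun j => (p j : ℂ) * f j t) (charFun ρ t) := by
      have := hasSum_integral_measure (hint ρ)
      rw [← charFun_apply_real] at this
      refine this.congr_fun fun j => ?_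
      rw [integral_smul_measure, ENNReal.toReal_ofReal (hp j), hfμ j, charFun_apply_real,
        Complex.real_smul]
    have hfin : IsFiniteMeasure (ENNReal.ofReal (1 - ∑' j, p j) • Measure.dirac (0 : ℝ)) :=
      Measure.smul_finite _ ENNReal.ofReal_ne_top
    rw [charFun_apply_real, integral_add_measure (hint _) (hint _), ← charFun_apply_real (μ := ρ),
      integral_smul_measure, integral_dirac, ENNReal.toReal_ofReal (sub_nonneg.mpr h1),
      ← hsum.tsum_eq]
    simp only [mul_sub, mul_one]
    rw [hsc.tsum_sub hsum.summable, ← Complex.ofReal_tsum]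
    simp
    ring

/-- Any sequence `a k (1 - f k)`, with `0 < a k` and characteristic functions `f k`, can be
followed asymptotically by rescaling a single characteristic function. -/
lemma exists_tendsto_mul_one_sub {f : ℕ → ℝ → ℂ} (hf : ∀ k, IsCF (f k)) {a : ℕ → ℝ}
    (ha : ∀ k, 0 < a k) :
    ∃ (g : ℝ → ℂ) (n : ℕ → ℕ) (α : ℕ → ℝ), IsCF g ∧ (∀ k, 0 < n k) ∧ Tendsto n atTop atTop ∧
      (∀ k, 0 < α k) ∧
      ∀ t, Tendsto (fun k => (n k : ℂ) * (1 - g (t / α k)) - a k * (1 - f k t)) atTop (𝓝 0) := by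
  obtain ⟨n, hn, hntop, hn1, hn2⟩ := exists_fast_growing_nat a
  -- `n` is fixed before `D` and `α`, so the scales can compensate for the size of `n k`.
  have hD : ∀ k : ℕ, ∃ D > 0, ∀ s : ℝ, |s| ≤ D → ∀ j < k, n k * ‖1 - f j s‖ ≤ 1 / (k + 1) := by
    intro k
    have hev : ∀ᶠ s in 𝓝 (0 : ℝ), ∀ j ∈ Finset.range k, n k * ‖1 - f j s‖ ≤ 1 / (k + 1) := by
      rw [Filter.eventually_all_finset]
      intro j _
      have hcont : Continuous fun s => (n k : ℝ) * ‖1 - f j s‖ := by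
        have := (hf j).continuous
        fun_prop
      refine (hcont.tendsto 0).eventually_le_const ?_
      simp only [(hf j).apply_zero, sub_self, norm_zero, mul_zero]
      positivity
    obtain ⟨D, hD, h⟩ := Metric.nhds_basis_closedBall.eventually_iff.mp hev
    exact ⟨D, hD, fun s hs j hj => h (by simpa using hs) j (Finset.mem_range.mpr hj)⟩
  choose D hD0 hD using hD
  obtain ⟨α, hα, hαD⟩ := exists_fast_growing_scale D hD0
  set p : ℕ → ℝ := fun j => a j / n j with hp
  have hn0 : ∀ k, (0 : ℝ) < n k := fun k => by exact_mod_cast hn k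
  have hp0 : ∀ j, 0 ≤ p j := fun j => (div_pos (ha j) (hn0 j)).le
  have hgeom : HasSum (fun j : ℕ => (1 / 2 : ℝ) ^ (j + 1)) 1 := by
    simpa [pow_succ] using hasSum_geometric_two.mul_right (1 / 2 : ℝ)
  have hps : Summable p := hgeom.summable.of_nonneg_of_le hp0 hn1
  have hp1 : ∑' j, p j ≤ 1 := (hps.tsum_le_tsum hn1 hgeom.summable).trans_eq hgeom.tsum_eq
  refine ⟨_, n, α, one_sub_tsum (fun j => (hf j).comp_mul_left (α j)) hp0 hps hp1, hn, hntop, hα,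
    fun t => ?_⟩
  set u : ℕ → ℕ → ℂ := fun k j => n k * (p j * (1 - f j (α j * (t / α k)))) with hu
  have hu_norm : ∀ k j, ‖u k j‖ = n k * p j * ‖1 - f j (α j * (t / α k))‖ := fun k j => by
    simp [hu, abs_of_nonneg (hp0 j), mul_assoc]
  have hu_sum : ∀ k, Summable (u k) := fun k => by
    refine Summable.mul_left _ (.of_norm_bounded (hps.mul_right 2) fun j => ?_)
    rw [norm_mul, Complex.norm_real, Real.norm_of_nonneg (hp0 j)]
    exact mul_le_mul_of_nonneg_left ((hf j).norm_one_sub_le_two _) (hp0 j)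
  have hu_diag : ∀ k, u k k = a k * (1 - f k t) := fun k => by
    have h1 : (n k : ℂ) ≠ 0 := by exact_mod_cast (hn k).ne'
    simp only [hu, hp, mul_div_cancel₀ t (hα k).ne']
    push_cast
    field_simp
  have hu_early : ∀ k j : ℕ, j < k → |t| ≤ k → ‖u k j‖ ≤ p j * (1 / (k + 1)) := by
    intro k j hjk htk
    rw [hu_norm, mul_comm (n k : ℝ), mul_assoc]
    exact mul_le_mul_of_nonneg_left (hD k _ (hαD k j hjk t htk) j hjk) (hp0 j)
  have hu_late : ∀ k j, k < j → ‖u k j‖ ≤ (1 / 2) ^ (j + 1) * 2 := by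
    intro k j hkj
    rw [hu_norm]
    exact mul_le_mul (hn2 k j hkj) ((hf j).norm_one_sub_le_two _) (norm_nonneg _) (by positivity)
  have htop : ∀ᶠ k : ℕ in atTop, |t| ≤ k :=
    tendsto_natCast_atTop_atTop.eventually_ge_atTop |t|
  -- Dominated convergence over `j`, diagonal removed. For fixed `j` eventually `k > j`, so the
  -- terms `j > k` need only the dominating bound.
  have hlim : Tendsto (fun k => ∑' j, if j = k then 0 else u k j) atTop (𝓝 (∑' _ : ℕ, (0 : ℂ))) := by
    refine tendsto_tsum_of_dominated_convergence (hgeom.summable.mul_right 2) (fun j => ?_) ?_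
    · have h0 : Tendsto (fun k : ℕ => p j * (1 / ((k : ℝ) + 1))) atTop (𝓝 0) := by
        simpa using tendsto_one_div_add_atTop_nhds_zero_nat.const_mul (p j)
      refine squeeze_zero_norm' ?_ h0
      filter_upwards [htop, eventually_gt_atTop j] with k htk hjk
      rw [if_neg hjk.ne]
      exact hu_early k j hjk htk
    · filter_upwards [htop] with k htk j
      rcases lt_trichotomy j k with h | h | h
      · rw [if_neg h.ne]
        refine (hu_early k j h htk).trans (mul_le_mul (hn1 j) ?_ (by positivity) (by positivity))
        rw [div_le_iff₀ (by positivity)]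
        have : (0 : ℝ) ≤ k := Nat.cast_nonneg k
        linarith
      · rw [if_pos h, norm_zero]
        positivity
      · rw [if_neg h.ne']
        exact hu_late k j h
  rw [tsum_zero] at hlim
  refine hlim.congr fun k => ?_
  rw [(hasSum_ite_sub_hasSum (hu_sum k).hasSum k).tsum_eq, hu_diag, sub_sub_cancel, tsum_mul_left]

end IsCF

/-- A Laplace transform is uniformly continuous on the closed right half-plane. -/
lemma IsLT.tendsto_sub {φ : ℂ → ℂ} (hφ : IsLT φ) {z w : ℕ → ℂ} (hz : ∀ k, 0 ≤ (z k).re)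
    (hw : ∀ k, 0 ≤ (w k).re) (h : Tendsto (fun k => z k - w k) atTop (𝓝 0)) :
    Tendsto (fun k => φ (z k) - φ (w k)) atTop (𝓝 0) := by
  obtain ⟨ν, _, hν, hφ⟩ := hφ
  have hpos : ∀ᵐ u ∂ν, 0 ≤ u := by
    filter_upwards [compl_mem_ae_iff.mpr hν] with u hu using not_lt.mp hu
  have hle : ∀ (x : ℂ) (u : ℝ), 0 ≤ x.re → 0 ≤ u → ‖Complex.exp (-(x * u))‖ ≤ 1 := by
    intro x u hx hu
    rw [Complex.norm_exp, Real.exp_le_one_iff]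
    simpa using mul_nonneg hx hu
  have hint : ∀ x : ℂ, 0 ≤ x.re → Integrable (fun u : ℝ => Complex.exp (-(x * u))) ν := by
    intro x hx
    refine Integrable.of_bound (by fun_prop) 1 ?_
    filter_upwards [hpos] with u hu using hle x u hx hu
  have heq : ∀ k, φ (z k) - φ (w k) =
      ∫ u : ℝ, (Complex.exp (-(z k * u)) - Complex.exp (-(w k * u))) ∂ν := fun k => by
    rw [hφ _ (hz k), hφ _ (hw k), integral_sub (hint _ (hz k)) (hint _ (hw k))]
  simp_rw [heq]
  rw [← integral_zero ℝ ℂ (μ := ν)]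
  refine tendsto_integral_of_dominated_convergence (fun _ => 2)
    (fun k => by fun_prop) (integrable_const _) (fun k => ?_) ?_
  · filter_upwards [hpos] with u hu
    refine (norm_sub_le _ _).trans ?_
    linarith [hle _ u (hz k) hu, hle _ u (hw k) hu]
  · filter_upwards [hpos] with u hu
    have hlim : Tendsto (fun k => ‖Complex.exp (-((z k - w k) * u)) - 1‖) atTop (𝓝 0) := by
      have hcont : Continuous fun x : ℂ => ‖Complex.exp (-(x * u)) - 1‖ := by fun_prop
      simpa [Function.comp_def] using (hcont.tendsto 0).comp h
    refine squeeze_zero_norm (fun k => ?_) hlim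
    -- Only `z k - w k` is controlled, as both sequences may be unbounded; the factor pulled out has
    -- norm at most 1.
    have : Complex.exp (-(z k * u)) - Complex.exp (-(w k * u)) =
        Complex.exp (-(w k * u)) * (Complex.exp (-((z k - w k) * u)) - 1) := by
      rw [mul_sub, ← Complex.exp_add, mul_one]
      ring_nf
    rw [this, norm_mul]
    exact mul_le_of_le_one_left (norm_nonneg _) (hle _ u (hw k) hu)

theorem theorem4p2 (φ : ℂ → ℂ) (hφ : IsLT φ) (f : ℝ → ℂ) (hf : IsCF f) :
    (partialPhiAttractionDomain φ f).Nonempty ↔ IsPhiID φ f := by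
  constructor
  · rintro ⟨g, hg, n, a, b, hn, -, -, h⟩
    exact ⟨fun k => n k, fun k => normedCF g (a k) (b k), fun k => Nat.cast_pos.mpr (hn k),
      fun k => hg.normedCF _ _, fun t => by simpa using h t⟩
  · rintro ⟨a, h, ha, hh, hlim⟩
    obtain ⟨g, n, α, hg, hn, hntop, hα, hgα⟩ := IsCF.exists_tendsto_mul_one_sub hh ha
    have hre : ∀ {e : ℝ → ℂ}, IsCF e → ∀ {c : ℝ}, 0 ≤ c → ∀ t, 0 ≤ ((c : ℂ) * (1 - e t)).re := by
      intro e he c hc t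
      rw [Complex.re_ofReal_mul, Complex.sub_re, Complex.one_re]
      exact mul_nonneg hc (sub_nonneg.mpr ((Complex.re_le_norm _).trans (he.norm_le_one t)))
    -- No centering is needed: the diagonal term is reproduced exactly.
    refine ⟨g, hg, n, α, fun _ => 0, hn, hntop, hα, fun t => ?_⟩
    have := hφ.tendsto_sub (fun k => by simpa using hre hg (n k).cast_nonneg (t / α k))
      (fun k => hre (hh k) (ha k).le t) (hgα t)
    simpa [normedCF] using this.add (hlim t)
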